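/- Let $Q_{3,2}\subset\mathbb{RP}^4$ be the quadric $-x_0^2+x_1^2+x_2^2+x_3^2-x_4^2=0$. A \emph{real rational parametrisation of a degree $d$ curve on $Q_{3,2}$} is a point $p=[p_0:\dots:p_4]$ of the real projective space $\mathbb{RP}^{5d+4}$ of $5$-tuples of real binary forms of degree $d$ in $s,t$, such that the $p_i$ have no common zero in $\mathbb{CP}^1$, $-p_0^2+p_1^2+p_2^2+p_3^2-p_4^2=0$, and the map $\mathbb{CP}^1\to\mathbb{CP}^4$ given by $p$ is birational onto its image (injective outside a finite set), so that the image is a curve of degree $d$. The curve is \emph{nonsingular} (a \emph{knot}) if this map $\mathbb{CP}^1\to\mathbb{CP}^4$ is an injective immersion, i.e. if there are no double points (real, solitary or non-real) and no cusps. An \emph{oriented knot} of degree $d$ is a nonsingular parametrisation up to the projective transformations of $\mathbb{RP}^1$ of positive determinant; an \emph{unoriented knot} is one up to all projective transformations of $\mathbb{RP}^1$. All these spaces carry the subspace and quotient topologies, and the \emph{rigid isotopy classes} are the path components of the space of (oriented or unoriented) knots of degree $d$. For degree $2$ the following hold. 1. Every real rational curve of degree $2$ on $Q_{3,2}$ is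 nonsingular. 2. The space of real rational parametrisations of degree $2$ curves on $Q_{3,2}$ has exactly three connected components. 3. There are exactly three rigid isotopy classes of oriented knots of degree $2$ on $Q_{3,2}$. 4. There are exactly two rigid isotopy classes of unoriented knots of degree $2$ on $Q_{3,2}$. 5. Under the map that forgets the orientation, exactly one oriented class lies over one of the two unoriented classes, and exactly two lie over the other. An oriented knot of degree $2$ is rigidly isotopic to the same knot with the reverse orientation if and only if it lies over the first of these two unoriented classes. -/

import Mathlib

open scoped LinearAlgebra.Projectivization Matrix

noncomputable section

namespace RealRationalCurve

/-- Five real binary forms of degree `d` in the variables `s, t`: the entry `p i k` is the coefficient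
of `s ^ (d - k) * t ^ k` in the `i`-th form. -/
abbrev FormTuple (d : ℕ) : Type := Fin 5 → Fin (d + 1) → ℝ

/-- The value of the five forms at `(s, t) = (x 0, x 1)`, where `K` is `ℝ` or `ℂ`. -/
def evalAt {d : ℕ} {K : Type*} [Field K] [Algebra ℝ K] (p : FormTuple d) (x : Fin 2 → K) :
    Fin 5 → K :=
  fun i => ∑ k : Fin (d + 1), algebraMap ℝ K (p i k) * (x 0 ^ (d - (k : ℕ)) * x 1 ^ (k : ℕ))

theorem evalAt_smul {d : ℕ} {K : Type*} [Field K] [Algebra ℝ K] (p : FormTuple d) (c : K)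
    (x : Fin 2 → K) : evalAt p (c • x) = c ^ d • evalAt p x := by
  funext i
  simp only [evalAt, Pi.smul_apply, smul_eq_mul, Finset.mul_sum]
  refine Finset.sum_congr rfl fun k _ => ?_
  have hk : (k : ℕ) ≤ d := Nat.lt_succ_iff.mp k.2
  have h : c ^ d = c ^ (d - (k : ℕ)) * c ^ (k : ℕ) := by
    rw [← pow_add, Nat.sub_add_cancel hk]
  rw [h, mul_pow, mul_pow]
  ring

/-- The quadratic form `-x₀² + x₁² + x₂² + x₃² - x₄²`, of signature `(3,2)`. -/
def quadric (x : Fin 5 → ℝ) : ℝ :=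
  -(x 0) ^ 2 + (x 1) ^ 2 + (x 2) ^ 2 + (x 3) ^ 2 - (x 4) ^ 2

/-- The five forms have no common zero in the complex projective line
(equivalently: no common factor). -/
def NoCommonZero {d : ℕ} (p : FormTuple d) : Prop :=
  ∀ x : Fin 2 → ℂ, x ≠ 0 → evalAt p x ≠ 0

/-- The map from the complex projective line to complex projective 4-space given by five forms
without common zeros. -/
def complexMap {d : ℕ} (p : FormTuple d) (hp : NoCommonZero p) :
    ℙ ℂ (Fin 2 → ℂ) → ℙ ℂ (Fin 5 → ℂ) :=
  Projectivization.lift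
    (fun x => Projectivization.mk ℂ (evalAt p x.1) (hp x.1 x.2)) (by
      rintro ⟨x, hx⟩ ⟨y, hy⟩ c hxy
      simp only at hxy
      subst hxy
      rw [Projectivization.mk_eq_mk_iff']
      exact ⟨c ^ d, (evalAt_smul p c y).symm⟩)

/-- `p` parametrises a real rational curve of degree `d` lying on the quadric `Q_{3,2}`: the forms have
no common factor, the real points lie on the quadric, and the parametrisation is birational onto its
image (that is, injective outside a finite set of complex points), so that the image is a
curve of degree `d` and not a curve of lower degree that is covered several times. -/
structure IsRationalCurve {d : ℕ} (p : FormTuple d) : Prop where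
  noCommonZero : NoCommonZero p
  onQuadric : ∀ x : Fin 2 → ℝ, quadric (evalAt p x) = 0
  birational :
    {P | ∃ P', P' ≠ P ∧ complexMap p noCommonZero P' = complexMap p noCommonZero P}.Finite

/-- Coefficient vectors of parametrisations of real rational curves of degree `d` on `Q_{3,2}`, with the
topology of the space of coefficients. -/
abbrev Param (d : ℕ) : Type := {p : FormTuple d // IsRationalCurve p}

/-- Two coefficient vectors give the same point of the real projective space of dimension
`5 * d + 4`. -/
def projSetoid (d : ℕ) : Setoid (Param d) where
  r p q := ∃ c : ℝ, c ≠ 0 ∧ q.1 = c • p.1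
  iseqv :=
    { refl := fun p => ⟨1, one_ne_zero, (one_smul ℝ p.1).symm⟩
      symm := by
        rintro p q ⟨c, hc, h⟩
        exact ⟨c⁻¹, inv_ne_zero hc, by rw [h, inv_smul_smul₀ hc]⟩
      trans := by
        rintro p q r ⟨c, hc, h⟩ ⟨e, he, h'⟩
        exact ⟨e * c, mul_ne_zero he hc, by rw [h', h, mul_smul]⟩ }

/-- The space of real rational parametrisations `[p₀ : p₁ : p₂ : p₃ : p₄]` of degree `d` curves on
`Q_{3,2}`, as a part of the real projective space of dimension `5 * d + 4`. -/
abbrev ParamSpace (d : ℕ) : Type := Quotient (projSetoid d)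

/-- The curve is nonsingular (also at its non-real points): it has no double points, real or solitary
or non-real, and no cusps. In homogeneous coordinates the map of projective spaces is an
immersion at a point exactly when the derivative of the map of vector spaces there is
injective, the degree being positive. -/
structure IsNonsingular {d : ℕ} (p : Param d) : Prop where
  injective : Function.Injective (complexMap p.1 p.2.noCommonZero)
  immersive : ∀ x : Fin 2 → ℂ, x ≠ 0 →
    Function.Injective (fderiv ℂ (fun y : Fin 2 → ℂ => evalAt p.1 y) x)

/-- Parametrisations of real rational knots of degree `d` in `Q_{3,2}`. -/
abbrev KnotParam (d : ℕ) : Type := {p : Param d // IsNonsingular p}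

/-- `q` is, as a point of projective space, the parametrisation `p` precomposed with the projective
transformation of the real projective line given by `g`. -/
def IsReparam {d : ℕ} (g : GL (Fin 2) ℝ) (p q : KnotParam d) : Prop :=
  ∃ c : ℝ, c ≠ 0 ∧ ∀ x : Fin 2 → ℝ, evalAt q.1.1 x = c • evalAt p.1.1 (g.1 *ᵥ x)

/-- Two knot parametrisations are identified when they differ by a projective transformation of the
real projective line that comes from the group `H`. -/
def reparamSetoid (d : ℕ) (H : Subgroup (GL (Fin 2) ℝ)) : Setoid (KnotParam d) where
  r p q := ∃ g ∈ H, IsReparam g p q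
  iseqv :=
    { refl := fun p => ⟨1, H.one_mem, 1, one_ne_zero, fun x => by simp⟩
      symm := by
        rintro p q ⟨g, hg, c, hc, h⟩
        refine ⟨g⁻¹, H.inv_mem hg, c⁻¹, inv_ne_zero hc, fun x => ?_⟩
        have hx : g.1 *ᵥ ((g⁻¹).1 *ᵥ x) = x := by
          rw [Matrix.mulVec_mulVec, ← Units.val_mul, mul_inv_cancel, Units.val_one,
            Matrix.one_mulVec]
        rw [h, hx, inv_smul_smul₀ hc]
      trans := by
        rintro p q r ⟨g, hg, c, hc, h⟩ ⟨g', hg', c', hc', h'⟩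
        refine ⟨g * g', H.mul_mem hg hg', c' * c, mul_ne_zero hc' hc, fun x => ?_⟩
        rw [h', h, mul_smul, Matrix.mulVec_mulVec, Units.val_mul] }

/-- The space of oriented real rational knots of degree `d` in `Q_{3,2}`: parametrisations up to
orientation-preserving projective transformations of the real projective line. -/
abbrev OrientedKnot (d : ℕ) : Type := Quotient (reparamSetoid d (Matrix.GLPos (Fin 2) ℝ))

/-- The space of real rational knots of degree `d` in `Q_{3,2}` without orientation: parametrisations up
to all projective transformations of the real projective line. -/
abbrev UnorientedKnot (d : ℕ) : Type := Quotient (reparamSetoid d ⊤)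

/-- The oriented knot with a given parametrisation. -/
def KnotParam.oriented {d : ℕ} (p : KnotParam d) : OrientedKnot d := Quotient.mk _ p

/-- The knot without orientation with a given parametrisation. -/
def KnotParam.unoriented {d : ℕ} (p : KnotParam d) : UnorientedKnot d := Quotient.mk _ p

/-- Forget the orientation of a knot. -/
def forget {d : ℕ} : OrientedKnot d → UnorientedKnot d :=
  Quotient.map' (s₁ := reparamSetoid d (Matrix.GLPos (Fin 2) ℝ)) (s₂ := reparamSetoid d ⊤) id
    (by rintro p q ⟨g, _, h⟩; exact ⟨g, Subgroup.mem_top g, h⟩)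

theorem continuous_forget {d : ℕ} : Continuous (forget (d := d)) :=
  Continuous.quotient_map' continuous_id _

/-- Rigid isotopy classes are the path components of the space of knots. Forgetting the orientation
induces a map from the oriented classes to the unoriented ones. -/
def forgetClass {d : ℕ} : ZerothHomotopy (OrientedKnot d) → ZerothHomotopy (UnorientedKnot d) :=
  Quotient.map' (s₁ := pathSetoid (OrientedKnot d)) (s₂ := pathSetoid (UnorientedKnot d)) forget
    (by rintro a b ⟨γ⟩; exact ⟨γ.map continuous_forget⟩)

/-- The rigid isotopy class of a knot without orientation. -/
def rigidClass {d : ℕ} (K : UnorientedKnot d) : ZerothHomotopy (UnorientedKnot d) :=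
  Quotient.mk (pathSetoid (UnorientedKnot d)) K

end RealRationalCurve

end

/-!
A curve `A s² + B s t + C t²` in `ℝ⁵` lies on the quadric exactly when the Gram matrix of `A, B, C`
is a certain matrix determined by `β = form B B` (`onQuadric_iff`). If `β = 0`, the three vectors
span an isotropic subspace; as such a subspace has dimension at most two, they are dependent, and the
parametrisation has a common zero or is a double cover of a line. If `β ≠ 0`, they are independent
over `ℂ`, so that the curve is a projectively embedded Veronese conic. Hence a rational curve of
degree two is the same as a triple with `β ≠ 0` (`isRationalCurve_iff`), and it is nonsingular.

For `β > 0` the plane of the conic has signature `(2,1)`, for `β < 0` it has signature `(1,2)`. In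
the second case the projection of the conic to the two negative coordinates winds around the origin,
that is, its Jacobian determinant has no zeros. The sign of this determinant gives the invariant
`turn`, with values in `SignType`, where the value `0` is reserved for `β > 0`. It is continuous,
unchanged by scaling and by substitutions of positive determinant, and changes its sign under
substitutions of negative determinant (`turn_of_isReparam`).

Conversely, `turn` determines the path component of a conic (`joined_iff_turn_eq`). The vectors
`B, A - C, A + C` are orthogonal with squares `β, β, -β`, and such frames are brought to a normal form
by rotations and boosts in coordinate planes, each of which is the end of a path of isometries that
starts at the identity. One normal form is reached for `β > 0`, and two, distinguished by a sign, for
`β < 0`. All the claims then follow from the action of reversal on the three values of `turn`.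
-/

namespace RealRationalCurve

/-! ### The equations of a conic on the quadric -/

/-- The signs of the diagonal quadratic form of signature `(3,2)`. -/
def eta : Fin 5 → ℝ := ![-1, 1, 1, 1, -1]

/-- The symmetric bilinear form with `quadric x = form x x`. -/
def form (x y : Fin 5 → ℝ) : ℝ := ∑ i, eta i * (x i * y i)

theorem form_apply (x y : Fin 5 → ℝ) :
    form x y = -(x 0 * y 0) + x 1 * y 1 + x 2 * y 2 + x 3 * y 3 - x 4 * y 4 := by
  simp only [form, eta, Fin.sum_univ_five, Matrix.cons_val]
  ring

/-- The coefficient vectors `A, B, C` of `A s² + B s t + C t²` have the Gram matrix that makes this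
vector isotropic for all `s, t`; the parameter is `β = form B B`. -/
structure IsConic (p : FormTuple 2) (β : ℝ) : Prop where
  form00 : form (p · 0) (p · 0) = 0
  form01 : form (p · 0) (p · 1) = 0
  form02 : form (p · 0) (p · 2) = -β / 2
  form11 : form (p · 1) (p · 1) = β
  form12 : form (p · 1) (p · 2) = 0
  form22 : form (p · 2) (p · 2) = 0

theorem evalAt_two {K : Type*} [Field K] [Algebra ℝ K] (p : FormTuple 2) (x : Fin 2 → K)
    (i : Fin 5) : evalAt p x i = algebraMap ℝ K (p i 0) * x 0 ^ 2 +
      algebraMap ℝ K (p i 1) * (x 0 * x 1) + algebraMap ℝ K (p i 2) * x 1 ^ 2 := by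
  simp [evalAt, Fin.sum_univ_three]

theorem quadric_evalAt (p : FormTuple 2) (x : Fin 2 → ℝ) :
    quadric (evalAt p x) = form (p · 0) (p · 0) * x 0 ^ 4 +
      2 * form (p · 0) (p · 1) * (x 0 ^ 3 * x 1) +
      (form (p · 1) (p · 1) + 2 * form (p · 0) (p · 2)) * (x 0 ^ 2 * x 1 ^ 2) +
      2 * form (p · 1) (p · 2) * (x 0 * x 1 ^ 3) + form (p · 2) (p · 2) * x 1 ^ 4 := by
  simp only [quadric, form_apply, evalAt_two, Algebra.algebraMap_self, RingHom.id_apply]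
  ring

theorem onQuadric_iff (p : FormTuple 2) :
    (∀ x : Fin 2 → ℝ, quadric (evalAt p x) = 0) ↔ ∃ β, IsConic p β := by
  constructor
  · intro h
    -- a binary quartic that vanishes at five points of the projective line is zero
    have h1 := h ![1, 0]
    have h2 := h ![0, 1]
    have h3 := h ![1, 1]
    have h4 := h ![1, -1]
    have h5 := h ![1, 2]
    simp only [quadric_evalAt, Matrix.cons_val_zero, Matrix.cons_val_one] at h1 h2 h3 h4 h5
    exact ⟨form (p · 1) (p · 1), by linarith, by linarith, by linarith, rfl, by linarith,
      by linarith⟩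
  · rintro ⟨β, h⟩ x
    rw [quadric_evalAt, h.form00, h.form01, h.form02, h.form11, h.form12, h.form22]
    ring

/-! ### Independent coefficient vectors give a nonsingular conic -/

/-- The Gram matrix is invertible when `β ≠ 0`, hence the three coefficient vectors are
linearly independent, also over `ℂ`. -/
theorem IsConic.eq_zero_of_combination {p : FormTuple 2} {β : ℝ} (h : IsConic p β) (hβ : β ≠ 0)
    {a b c : ℂ} (H : ∀ i, (p i 0 : ℂ) * a + (p i 1 : ℂ) * b + (p i 2 : ℂ) * c = 0) :
    a = 0 ∧ b = 0 ∧ c = 0 := by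
  obtain ⟨e00, e01, e02, e11, e12, e22⟩ := h
  rw [form_apply] at e00 e01 e02 e11 e12 e22
  have hβ' : (β : ℂ) ≠ 0 := by exact_mod_cast hβ
  have f00 := congrArg (fun r : ℝ => (r : ℂ)) e00
  have f01 := congrArg (fun r : ℝ => (r : ℂ)) e01
  have f02 := congrArg (fun r : ℝ => (r : ℂ)) e02
  have f11 := congrArg (fun r : ℝ => (r : ℂ)) e11
  have f12 := congrArg (fun r : ℝ => (r : ℂ)) e12
  have f22 := congrArg (fun r : ℝ => (r : ℂ)) e22
  push_cast at f00 f01 f02 f11 f12 f22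
  have k0 := H 0
  have k1 := H 1
  have k2 := H 2
  have k3 := H 3
  have k4 := H 4
  have ha : (β : ℂ) * a = 0 := by
    linear_combination (2 * p 0 2) * k0 - (2 * p 1 2) * k1 - (2 * p 2 2) * k2 - (2 * p 3 2) * k3 +
      (2 * p 4 2) * k4 + 2 * a * f02 + 2 * b * f12 + 2 * c * f22
  have hb : (β : ℂ) * b = 0 := by
    linear_combination -(p 0 1 : ℂ) * k0 + (p 1 1 : ℂ) * k1 + (p 2 1 : ℂ) * k2 + (p 3 1 : ℂ) * k3 -
      (p 4 1 : ℂ) * k4 - a * f01 - b * f11 - c * f12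
  have hc : (β : ℂ) * c = 0 := by
    linear_combination (2 * p 0 0) * k0 - (2 * p 1 0) * k1 - (2 * p 2 0) * k2 - (2 * p 3 0) * k3 +
      (2 * p 4 0) * k4 + 2 * a * f00 + 2 * b * f01 + 2 * c * f02
  exact ⟨(mul_eq_zero.mp ha).resolve_left hβ', (mul_eq_zero.mp hb).resolve_left hβ',
    (mul_eq_zero.mp hc).resolve_left hβ'⟩

theorem IsConic.noCommonZero {p : FormTuple 2} {β : ℝ} (h : IsConic p β) (hβ : β ≠ 0) :
    NoCommonZero p := by
  intro x hx h0
  obtain ⟨h1, -, h2⟩ := h.eq_zero_of_combination hβ (a := x 0 ^ 2) (b := x 0 * x 1)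
    (c := x 1 ^ 2) fun i => by simpa [evalAt_two] using congrFun h0 i
  apply hx
  ext i
  fin_cases i
  · simpa using h1
  · simpa using h2

/-- Two points of a projective line agree when their homogeneous coordinates have determinant
zero. -/
theorem mk_eq_mk_of_det {x y : Fin 2 → ℂ} (hx : x ≠ 0) (hy : y ≠ 0)
    (h : x 0 * y 1 - x 1 * y 0 = 0) : Projectivization.mk ℂ x hx = Projectivization.mk ℂ y hy := by
  rw [Projectivization.mk_eq_mk_iff']
  by_cases h0 : y 0 = 0
  · have h1 : y 1 ≠ 0 := fun h1 => hy (by ext i; fin_cases i <;> simp [h0, h1])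
    have hx0 : x 0 = 0 := by
      rw [h0, mul_zero, sub_zero] at h
      exact (mul_eq_zero.mp h).resolve_right h1
    refine ⟨x 1 / y 1, ?_⟩
    ext i
    fin_cases i
    · simp [h0, hx0]
    · simp [h1]
  · refine ⟨x 0 / y 0, ?_⟩
    ext i
    fin_cases i
    · simp [h0]
    · simp only [Pi.smul_apply, smul_eq_mul, Fin.mk_one]
      field_simp
      linear_combination h

theorem IsConic.injective_complexMap {p : FormTuple 2} {β : ℝ} (h : IsConic p β) (hβ : β ≠ 0)
    (hp : NoCommonZero p) : Function.Injective (complexMap p hp) := by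
  intro P Q
  induction P using Projectivization.ind with | _ x hx
  induction Q using Projectivization.ind with | _ y hy
  intro hPQ
  have hPQ' : Projectivization.mk ℂ (evalAt p x) (hp x hx) =
    Projectivization.mk ℂ (evalAt p y) (hp y hy) := hPQ
  rw [Projectivization.mk_eq_mk_iff'] at hPQ'
  obtain ⟨c, hc⟩ := hPQ'
  obtain ⟨h0, h1, h2⟩ := h.eq_zero_of_combination hβ (a := c * y 0 ^ 2 - x 0 ^ 2)
    (b := c * (y 0 * y 1) - x 0 * x 1) (c := c * y 1 ^ 2 - x 1 ^ 2) fun i => by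
      have := congrFun hc i
      simp only [Pi.smul_apply, smul_eq_mul, evalAt_two, Complex.coe_algebraMap] at this
      linear_combination this
  apply mk_eq_mk_of_det
  have : (x 0 * y 1 - x 1 * y 0) ^ 2 = 0 := by
    linear_combination -y 1 ^ 2 * h0 + 2 * y 0 * y 1 * h1 - y 0 ^ 2 * h2
  exact pow_eq_zero_iff two_ne_zero |>.mp this

theorem IsConic.isRationalCurve {p : FormTuple 2} {β : ℝ} (h : IsConic p β) (hβ : β ≠ 0) :
    IsRationalCurve p where
  noCommonZero := h.noCommonZero hβ
  onQuadric := (onQuadric_iff p).mpr ⟨β, h⟩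
  birational := by
    convert Set.finite_empty
    ext P
    simp only [Set.mem_ofPred_eq, Set.mem_empty_iff_false, iff_false]
    rintro ⟨P', hne, he⟩
    exact hne (h.injective_complexMap hβ _ he)

theorem hasFDerivAt_evalAt_two (p : FormTuple 2) (x : Fin 2 → ℂ) :
    HasFDerivAt (fun y : Fin 2 → ℂ => evalAt p y)
      (ContinuousLinearMap.pi fun i =>
        ((p i 0 : ℂ) * (2 * x 0) + (p i 1 : ℂ) * x 1) •
          (ContinuousLinearMap.proj 0 : (Fin 2 → ℂ) →L[ℂ] ℂ) +
        ((p i 1 : ℂ) * x 0 + (p i 2 : ℂ) * (2 * x 1)) •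
          (ContinuousLinearMap.proj 1 : (Fin 2 → ℂ) →L[ℂ] ℂ)) x := by
  rw [hasFDerivAt_pi]
  intro i
  have h0 : HasFDerivAt (fun y : Fin 2 → ℂ => y 0)
    (ContinuousLinearMap.proj (R := ℂ) (φ := fun _ : Fin 2 => ℂ) 0) x := hasFDerivAt_apply 0 x
  have h1 : HasFDerivAt (fun y : Fin 2 → ℂ => y 1)
    (ContinuousLinearMap.proj (R := ℂ) (φ := fun _ : Fin 2 => ℂ) 1) x := hasFDerivAt_apply 1 x
  simp only [evalAt_two, Complex.coe_algebraMap]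
  refine HasFDerivAt.congr_fderiv ((((h0.pow 2).const_mul (p i 0 : ℂ)).add
    ((h0.mul h1).const_mul (p i 1 : ℂ))).add ((h1.pow 2).const_mul (p i 2 : ℂ))) ?_
  refine ContinuousLinearMap.ext fun v => ?_
  simp
  ring

theorem IsConic.immersive {p : FormTuple 2} {β : ℝ} (h : IsConic p β) (hβ : β ≠ 0)
    (x : Fin 2 → ℂ) (hx : x ≠ 0) :
    Function.Injective (fderiv ℂ (fun y : Fin 2 → ℂ => evalAt p y) x) := by
  rw [(hasFDerivAt_evalAt_two p x).fderiv, injective_iff_map_eq_zero]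
  intro v hv
  obtain ⟨h0, h1, h2⟩ := h.eq_zero_of_combination hβ (a := 2 * x 0 * v 0)
    (b := x 1 * v 0 + x 0 * v 1) (c := 2 * x 1 * v 1) fun i => by
      have := congrFun hv i
      simp only [ContinuousLinearMap.pi_apply, add_apply,
        smul_apply, ContinuousLinearMap.proj_apply, smul_eq_mul,
        Pi.zero_apply] at this
      linear_combination this
  have k0 : v 0 = 0 ∧ v 1 = 0 := by
    by_cases hx0 : x 0 = 0
    · have hx1 : x 1 ≠ 0 := fun h1 => hx (by ext i; fin_cases i <;> simp [hx0, h1])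
      simp_all
    · simp_all
  ext i
  fin_cases i
  · simpa using k0.1
  · simpa using k0.2

/-! ### Dependent coefficient vectors give a double cover -/

/-- There is no isotropic subspace of dimension three: the projection to the two negative coordinates
kills a nonzero combination, on which the form is positive definite. -/
theorem IsConic.exists_relation {p : FormTuple 2} (h : IsConic p 0) :
    ∃ a b c : ℝ, ¬(a = 0 ∧ b = 0 ∧ c = 0) ∧ ∀ i, p i 0 * a + p i 1 * b + p i 2 * c = 0 := by
  have hker : LinearMap.ker (Matrix.mulVecLin (Matrix.of ![p 0, p 4])) ≠ ⊥ :=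
    LinearMap.ker_ne_bot_of_finrank_lt (by simp)
  obtain ⟨v, hv, hv0⟩ := Submodule.exists_mem_ne_zero_of_ne_bot hker
  rw [LinearMap.mem_ker, Matrix.mulVecLin_apply] at hv
  have k0 := congrFun hv 0
  have k4 := congrFun hv 1
  simp [Matrix.mulVec, dotProduct, Fin.sum_univ_three] at k0 k4
  refine ⟨v 0, v 1, v 2, ?_, ?_⟩
  · rintro ⟨h0, h1, h2⟩
    exact hv0 (by ext i; fin_cases i <;> simpa)
  obtain ⟨e00, e01, e02, e11, e12, e22⟩ := h
  rw [form_apply] at e00 e01 e02 e11 e12 e22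
  have key : ∀ x y z : ℝ, x ^ 2 + y ^ 2 + z ^ 2 = 0 → x = 0 ∧ y = 0 ∧ z = 0 := fun x y z h =>
    ⟨pow_eq_zero_iff two_ne_zero |>.mp (by linarith [sq_nonneg x, sq_nonneg y, sq_nonneg z]),
      pow_eq_zero_iff two_ne_zero |>.mp (by linarith [sq_nonneg x, sq_nonneg y, sq_nonneg z]),
      pow_eq_zero_iff two_ne_zero |>.mp (by linarith [sq_nonneg x, sq_nonneg y, sq_nonneg z])⟩
  obtain ⟨k1, k2, k3⟩ := key (p 1 0 * v 0 + p 1 1 * v 1 + p 1 2 * v 2)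
    (p 2 0 * v 0 + p 2 1 * v 1 + p 2 2 * v 2) (p 3 0 * v 0 + p 3 1 * v 1 + p 3 2 * v 2) (by
      linear_combination v 0 ^ 2 * e00 + 2 * v 0 * v 1 * e01 + 2 * v 0 * v 2 * e02 +
        v 1 ^ 2 * e11 + 2 * v 1 * v 2 * e12 + v 2 ^ 2 * e22 +
        (p 0 0 * v 0 + p 0 1 * v 1 + p 0 2 * v 2) * k0 +
        (p 4 0 * v 0 + p 4 1 * v 1 + p 4 2 * v 2) * k4)
  intro i
  fin_cases i
  exacts [k0, k1, k2, k3, k4]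

/-- A linear relation between the coefficient vectors is a point `(a, b, c)` of the plane of the
Veronese conic. If it lies on the conic, the forms have a common zero. Otherwise the lines through it
cut the conic in pairs of points with the same image. -/
theorem not_isRationalCurve_of_relation {p : FormTuple 2} {a b c : ℝ}
    (h0 : ¬(a = 0 ∧ b = 0 ∧ c = 0)) (H : ∀ i, p i 0 * a + p i 1 * b + p i 2 * c = 0) :
    ¬IsRationalCurve p := by
  intro hp
  have HC : ∀ i, (p i 0 : ℂ) * a + (p i 1 : ℂ) * b + (p i 2 : ℂ) * c = 0 := fun i => by
    exact_mod_cast H i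
  have hdisc : b ^ 2 - a * c ≠ 0 := by
    intro hd
    have hd' : (b : ℂ) ^ 2 - a * c = 0 := by exact_mod_cast hd
    by_cases ha : a = 0
    · have hb : b = 0 := by simpa [ha] using hd
      have hc : (c : ℂ) ≠ 0 := by
        have : c ≠ 0 := fun hc => h0 ⟨ha, hb, hc⟩
        exact_mod_cast this
      refine hp.noCommonZero ![0, 1] (fun h => by simpa using congrFun h 1) ?_
      ext i
      have := HC i
      simp only [ha, hb, Complex.ofReal_zero, mul_zero, zero_add, mul_eq_zero, hc, or_false] at this
      simp [evalAt_two, this]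
    · have ha' : (a : ℂ) ≠ 0 := by exact_mod_cast ha
      refine hp.noCommonZero ![(a : ℂ), b] (fun h => ha' (by simpa using congrFun h 0)) ?_
      ext i
      simp only [evalAt_two, Complex.coe_algebraMap, Matrix.cons_val_zero, Matrix.cons_val_one,
        Pi.zero_apply]
      linear_combination a * HC i + (p i 2 : ℂ) * hd'
  have hdisc' : (b : ℂ) ^ 2 - a * c ≠ 0 := by exact_mod_cast hdisc
  -- `P u` is the point `[1 : u]`, and the second point on the line is `[a u - b : b u - c]`
  have hne : ∀ u : ℝ, ![(1 : ℂ), u] ≠ 0 := fun u h => by simpa using congrFun h 0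
  let P : ℝ → ℙ ℂ (Fin 2 → ℂ) := fun u => Projectivization.mk ℂ ![(1 : ℂ), u] (hne u)
  have hP : Function.Injective P := by
    intro u v huv
    rw [Projectivization.mk_eq_mk_iff'] at huv
    obtain ⟨e, he⟩ := huv
    have e0 := congrFun he 0
    have e1 := congrFun he 1
    simp only [Pi.smul_apply, smul_eq_mul, Matrix.cons_val_zero, Matrix.cons_val_one,
      mul_one] at e0 e1
    rw [e0, one_mul] at e1
    exact_mod_cast e1.symm
  let f : Polynomial ℝ := Polynomial.C a * Polynomial.X ^ 2 +
    Polynomial.C (-2 * b) * Polynomial.X + Polynomial.C c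
  have hf : f ≠ 0 := by
    intro hf
    have f0 : f.coeff 0 = 0 := by rw [hf, Polynomial.coeff_zero]
    have f1 : f.coeff 1 = 0 := by rw [hf, Polynomial.coeff_zero]
    have f2 : f.coeff 2 = 0 := by rw [hf, Polynomial.coeff_zero]
    simp [f, Polynomial.coeff_X, Polynomial.coeff_C] at f0 f1 f2
    exact h0 ⟨f2, f1, f0⟩
  have hinf : {u : ℝ | ¬ f.IsRoot u}.Infinite :=
    (Polynomial.finite_setOfPred_isRoot hf).infinite_compl
  refine hinf.image hP.injOn (hp.birational.subset ?_)
  rintro _ ⟨u, hu, rfl⟩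
  have hu' : (a : ℂ) * u ^ 2 - 2 * b * u + c ≠ 0 := by
    intro h
    apply hu
    have : a * u ^ 2 - 2 * b * u + c = 0 := by exact_mod_cast h
    simp only [Polynomial.IsRoot.def, f, Polynomial.eval_add, Polynomial.eval_mul,
      Polynomial.eval_C, Polynomial.eval_pow, Polynomial.eval_X]
    linear_combination this
  have hy : ![(a : ℂ) * u - b, b * u - c] ≠ 0 := by
    intro h
    have y0 := congrFun h 0
    have y1 := congrFun h 1
    simp only [Matrix.cons_val_zero, Matrix.cons_val_one, Pi.zero_apply] at y0 y1
    exact hdisc' (by linear_combination a * y1 - b * y0)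
  refine ⟨Projectivization.mk ℂ _ hy, ?_, ?_⟩
  · intro h
    rw [Projectivization.mk_eq_mk_iff'] at h
    obtain ⟨e, he⟩ := h
    have e0 := congrFun he 0
    have e1 := congrFun he 1
    simp only [Pi.smul_apply, smul_eq_mul, Matrix.cons_val_zero, Matrix.cons_val_one,
      mul_one] at e0 e1
    exact hu' (by linear_combination e1 - u * e0)
  · change Projectivization.mk ℂ (evalAt p _) _ = Projectivization.mk ℂ (evalAt p _) _
    rw [Projectivization.mk_eq_mk_iff']
    refine ⟨(b : ℂ) ^ 2 - a * c, ?_⟩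
    ext i
    simp only [Pi.smul_apply, smul_eq_mul, evalAt_two, Complex.coe_algebraMap,
      Matrix.cons_val_zero, Matrix.cons_val_one]
    linear_combination -((a : ℂ) * u ^ 2 - 2 * b * u + c) * HC i

theorem isRationalCurve_iff (p : FormTuple 2) :
    IsRationalCurve p ↔ ∃ β, β ≠ 0 ∧ IsConic p β := by
  constructor
  · intro h
    obtain ⟨β, hβ⟩ := (onQuadric_iff p).mp h.onQuadric
    refine ⟨β, ?_, hβ⟩
    rintro rfl
    obtain ⟨a, b, c, h0, H⟩ := hβ.exists_relation
    exact not_isRationalCurve_of_relation h0 H h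
  · rintro ⟨β, hβ, h⟩
    exact h.isRationalCurve hβ

theorem isNonsingular_of_degree_two (p : Param 2) : IsNonsingular p := by
  obtain ⟨β, hβ, h⟩ := (isRationalCurve_iff p.1).mp p.2
  exact ⟨h.injective_complexMap hβ _, h.immersive hβ⟩

/-! ### The sense of rotation of a conic -/

/-- The Jacobian determinant at `(s, t) = (1, 0)` of the projection of the conic to the two negative
coordinates. -/
def negDet (p : FormTuple 2) : ℝ := p 0 0 * p 4 1 - p 4 0 * p 0 1

/-- The sense in which the projection of the conic to the two negative coordinates turns, if the plane
of the conic has signature `(1,2)`; zero if it has signature `(2,1)`. -/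
noncomputable def turn (p : FormTuple 2) : SignType :=
  if 0 < form (p · 1) (p · 1) then 0 else SignType.sign (negDet p)

theorem IsConic.turn_of_pos {p : FormTuple 2} {β : ℝ} (h : IsConic p β) (hβ : 0 < β) :
    turn p = 0 := by
  rw [turn, h.form11, if_pos hβ]

theorem IsConic.turn_of_neg {p : FormTuple 2} {β : ℝ} (h : IsConic p β) (hβ : β < 0) :
    turn p = SignType.sign (negDet p) := by
  rw [turn, h.form11, if_neg hβ.not_gt]

/-- If the projections of `A` and `B` to the negative coordinates were proportional, a combination of
`A` and `B` with a nonzero coefficient at `B` would lie in the positive definite subspace, although the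
form takes negative values on such combinations. -/
theorem IsConic.negDet_ne_zero {p : FormTuple 2} {β : ℝ} (h : IsConic p β) (hβ : β < 0) :
    negDet p ≠ 0 := by
  intro hD
  obtain ⟨e00, e01, e02, e11, e12, e22⟩ := h
  rw [form_apply] at e00 e01 e02 e11 e12 e22
  rw [negDet] at hD
  have h0 : p 0 0 = 0 := by
    have : 0 ≤ p 0 0 ^ 2 * β := by
      have : p 0 0 ^ 2 * β = (p 0 0 * p 1 1 - p 0 1 * p 1 0) ^ 2 +
          (p 0 0 * p 2 1 - p 0 1 * p 2 0) ^ 2 + (p 0 0 * p 3 1 - p 0 1 * p 3 0) ^ 2 := by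
        linear_combination -p 0 0 ^ 2 * e11 + 2 * p 0 0 * p 0 1 * e01 - p 0 1 ^ 2 * e00 -
          (p 0 0 * p 4 1 - p 4 0 * p 0 1) * hD
      rw [this]
      positivity
    by_contra hne
    have := mul_neg_of_pos_of_neg (sq_pos_of_ne_zero hne) hβ
    linarith
  have h4 : p 4 0 = 0 := by
    have : 0 ≤ p 4 0 ^ 2 * β := by
      have : p 4 0 ^ 2 * β = (p 4 0 * p 1 1 - p 4 1 * p 1 0) ^ 2 +
          (p 4 0 * p 2 1 - p 4 1 * p 2 0) ^ 2 + (p 4 0 * p 3 1 - p 4 1 * p 3 0) ^ 2 := by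
        linear_combination -p 4 0 ^ 2 * e11 + 2 * p 4 0 * p 4 1 * e01 - p 4 1 ^ 2 * e00 -
          (p 0 0 * p 4 1 - p 4 0 * p 0 1) * hD
      rw [this]
      positivity
    by_contra hne
    have := mul_neg_of_pos_of_neg (sq_pos_of_ne_zero hne) hβ
    linarith
  rw [h0, h4] at e00
  have h1 : p 1 0 = 0 := pow_eq_zero_iff two_ne_zero |>.mp
    (by linarith [sq_nonneg (p 1 0), sq_nonneg (p 2 0), sq_nonneg (p 3 0)])
  have h2 : p 2 0 = 0 := pow_eq_zero_iff two_ne_zero |>.mp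
    (by linarith [sq_nonneg (p 1 0), sq_nonneg (p 2 0), sq_nonneg (p 3 0)])
  have h3 : p 3 0 = 0 := pow_eq_zero_iff two_ne_zero |>.mp
    (by linarith [sq_nonneg (p 1 0), sq_nonneg (p 2 0), sq_nonneg (p 3 0)])
  rw [h0, h1, h2, h3, h4] at e02
  linarith

theorem continuous_form_columns {k l : Fin 3} :
    Continuous fun p : FormTuple 2 => form (p · k) (p · l) := by
  simp only [form_apply]
  fun_prop

theorem continuous_negDet : Continuous negDet := by
  unfold negDet
  fun_prop

theorem continuous_turn : Continuous fun p : Param 2 => turn p.1 := by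
  rw [continuous_iff_continuousAt]
  intro p
  obtain ⟨β, hβ, h⟩ := (isRationalCurve_iff p.1).mp p.2
  have hc : Continuous fun q : Param 2 => form (q.1 · 1) (q.1 · 1) :=
    continuous_form_columns.comp continuous_subtype_val
  rcases lt_or_gt_of_ne hβ with hβ | hβ
  · have hs : ContinuousAt (fun q : Param 2 => SignType.sign (negDet q.1)) p :=
      (continuousAt_sign_of_ne_zero (h.negDet_ne_zero hβ)).comp
        (f := fun q : Param 2 => negDet q.1)
        (continuous_negDet.comp continuous_subtype_val).continuousAt
    refine hs.congr ?_
    filter_upwards [hc.continuousAt.eventually_lt (continuousAt_const (y := (0 : ℝ)))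
      (by rwa [h.form11])] with q hq
    rw [turn, if_neg hq.not_gt]
  · refine (continuousAt_const (y := (0 : SignType))).congr ?_
    filter_upwards [(continuousAt_const (y := (0 : ℝ))).eventually_lt hc.continuousAt
      (by rwa [h.form11])] with q hq
    rw [turn, if_pos hq]

/-! ### Substitution in the binary forms -/

/-- The coefficients of the binary forms of `p` after the linear substitution `g`. -/
def subst (g : Matrix (Fin 2) (Fin 2) ℝ) (p : FormTuple 2) : FormTuple 2 := fun i =>
  ![p i 0 * g 0 0 ^ 2 + p i 1 * (g 0 0 * g 1 0) + p i 2 * g 1 0 ^ 2,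
    p i 0 * (2 * g 0 0 * g 0 1) + p i 1 * (g 0 0 * g 1 1 + g 0 1 * g 1 0) +
      p i 2 * (2 * g 1 0 * g 1 1),
    p i 0 * g 0 1 ^ 2 + p i 1 * (g 0 1 * g 1 1) + p i 2 * g 1 1 ^ 2]

theorem evalAt_subst (g : Matrix (Fin 2) (Fin 2) ℝ) (p : FormTuple 2) (x : Fin 2 → ℝ) :
    evalAt (subst g p) x = evalAt p (g *ᵥ x) := by
  ext i
  simp only [evalAt_two, subst, Matrix.mulVec, dotProduct, Fin.sum_univ_two,
    Algebra.algebraMap_self, RingHom.id_apply, Matrix.cons_val]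
  ring

theorem evalAt_smul_left (c : ℝ) (p : FormTuple 2) (x : Fin 2 → ℝ) :
    evalAt (c • p) x = c • evalAt p x := by
  ext i
  simp only [evalAt_two, Pi.smul_apply, smul_eq_mul, Algebra.algebraMap_self, RingHom.id_apply]
  ring

theorem evalAt_injective {p q : FormTuple 2} (h : ∀ x : Fin 2 → ℝ, evalAt p x = evalAt q x) :
    p = q := by
  ext i k
  have h0 := congrFun (h ![1, 0]) i
  have h1 := congrFun (h ![0, 1]) i
  have h2 := congrFun (h ![1, 1]) i
  simp [evalAt_two] at h0 h1 h2
  rw [h0, h1] at h2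
  fin_cases k
  · exact h0
  · simpa using h2
  · exact h1

theorem isReparam_iff {g : GL (Fin 2) ℝ} {p q : KnotParam 2} :
    IsReparam g p q ↔ ∃ c : ℝ, c ≠ 0 ∧ q.1.1 = c • subst g.1 p.1.1 := by
  refine exists_congr fun c => and_congr_right fun _ => ⟨fun h => evalAt_injective fun x => ?_,
    fun h x => ?_⟩
  · rw [h, evalAt_smul_left, evalAt_subst]
  · rw [h, evalAt_smul_left, evalAt_subst]

theorem IsConic.smul {p : FormTuple 2} {β : ℝ} (h : IsConic p β) (c : ℝ) :
    IsConic (c • p) (c ^ 2 * β) := by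
  have key : ∀ k l, form ((c • p) · k) ((c • p) · l) = c ^ 2 * form (p · k) (p · l) := by
    intro k l
    simp only [form_apply, Pi.smul_apply, smul_eq_mul]
    ring
  constructor <;> rw [key]
  · rw [h.form00, mul_zero]
  · rw [h.form01, mul_zero]
  · rw [h.form02]; ring
  · rw [h.form11]
  · rw [h.form12, mul_zero]
  · rw [h.form22, mul_zero]

theorem IsConic.subst {p : FormTuple 2} {β : ℝ} (h : IsConic p β)
    (g : Matrix (Fin 2) (Fin 2) ℝ) : IsConic (subst g p) (g.det ^ 2 * β) := by
  have key : ∀ x y z x' y' z' : ℝ, form (fun i => p i 0 * x + p i 1 * y + p i 2 * z)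
      (fun i => p i 0 * x' + p i 1 * y' + p i 2 * z') =
        β * (y * y') - β / 2 * (x * z' + z * x') := by
    intro x y z x' y' z'
    obtain ⟨e00, e01, e02, e11, e12, e22⟩ := h
    rw [form_apply] at *
    linear_combination x * x' * e00 + (x * y' + y * x') * e01 + (x * z' + z * x') * e02 +
      y * y' * e11 + (y * z' + z * y') * e12 + z * z' * e22
  constructor <;> simp only [RealRationalCurve.subst, Matrix.cons_val, key, Matrix.det_fin_two] <;>
    ring

theorem negDet_smul (c : ℝ) (p : FormTuple 2) : negDet (c • p) = c ^ 2 * negDet p := by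
  simp only [negDet, Pi.smul_apply, smul_eq_mul]
  ring

/-- The Jacobian determinant of the projection to the negative coordinates is covariant under
substitutions; the second factor is its value at the image of `(1, 0)`. -/
theorem negDet_subst (g : Matrix (Fin 2) (Fin 2) ℝ) (p : FormTuple 2) :
    negDet (subst g p) = g.det * (negDet p * g 0 0 ^ 2 +
      2 * (p 0 0 * p 4 2 - p 4 0 * p 0 2) * (g 0 0 * g 1 0) +
      (p 0 1 * p 4 2 - p 4 1 * p 0 2) * g 1 0 ^ 2) := by
  simp only [negDet, subst, Matrix.cons_val, Matrix.det_fin_two]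
  ring

/-- A real binary quadratic form `a s² + 2 b s t + c t²` without real zeros has the sign of `a`. -/
theorem sign_binary_quadratic {a b c : ℝ}
    (h : ∀ s t : ℝ, (s ≠ 0 ∨ t ≠ 0) → a * s ^ 2 + 2 * b * (s * t) + c * t ^ 2 ≠ 0) {s t : ℝ}
    (hst : s ≠ 0 ∨ t ≠ 0) :
    SignType.sign (a * s ^ 2 + 2 * b * (s * t) + c * t ^ 2) = SignType.sign a := by
  have ha : a ≠ 0 := by simpa using h 1 0 (Or.inl one_ne_zero)
  have hd : b ^ 2 - a * c < 0 := by
    by_contra hd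
    push Not at hd
    -- otherwise the quadratic formula gives a zero
    refine h (-b + √(b ^ 2 - a * c)) a (Or.inr ha) ?_
    linear_combination a * Real.sq_sqrt hd
  have hpos : 0 < a * (a * s ^ 2 + 2 * b * (s * t) + c * t ^ 2) := by
    have e : a * (a * s ^ 2 + 2 * b * (s * t) + c * t ^ 2) =
        (a * s + b * t) ^ 2 + -(b ^ 2 - a * c) * t ^ 2 := by ring
    rw [e]
    by_cases ht : t = 0
    · have hs : s ≠ 0 := by simpa [ht] using hst
      have : 0 < (a * s) ^ 2 := by positivity
      rw [ht]
      linarith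
    · have : 0 < -(b ^ 2 - a * c) := by linarith
      positivity
  rcases lt_or_gt_of_ne ha with h0 | h0
  · rw [sign_neg h0, sign_neg (by nlinarith)]
  · rw [sign_pos h0, sign_pos (by nlinarith)]

theorem IsConic.turn_smul_subst {p : FormTuple 2} {β : ℝ} (h : IsConic p β) (hβ : β ≠ 0) {c : ℝ}
    (hc : c ≠ 0) {g : Matrix (Fin 2) (Fin 2) ℝ} (hg : g.det ≠ 0) :
    turn (c • RealRationalCurve.subst g p) = SignType.sign g.det * turn p := by
  have h' := (h.subst g).smul c
  have hc2 : 0 < c ^ 2 := by positivity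
  have hg2 : 0 < g.det ^ 2 := by positivity
  rcases lt_or_gt_of_ne hβ with hn | hp
  · rw [h.turn_of_neg hn, h'.turn_of_neg
      (mul_neg_of_pos_of_neg hc2 (mul_neg_of_pos_of_neg hg2 hn)), negDet_smul, sign_mul,
      sign_pos hc2, one_mul, negDet_subst, sign_mul]
    congr 1
    refine sign_binary_quadratic (fun s t hst h0 => ?_) ?_
    · -- the rotation that takes `(1, 0)` to the direction of `(s, t)` has nonzero determinant
      have hdet : (!![s, -t; t, s] : Matrix (Fin 2) (Fin 2) ℝ).det ≠ 0 := by
        have : s ^ 2 + t ^ 2 ≠ 0 := by rcases hst with h | h <;> positivity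
        rw [Matrix.det_fin_two_of]
        intro h
        exact this (by linear_combination h)
      have h2 : 0 < (!![s, -t; t, s] : Matrix (Fin 2) (Fin 2) ℝ).det ^ 2 := by positivity
      refine (h.subst !![s, -t; t, s]).negDet_ne_zero (mul_neg_of_pos_of_neg h2 hn) ?_
      rw [negDet_subst]
      refine mul_eq_zero_of_right _ ?_
      simpa using h0
    · by_contra hcon
      push Not at hcon
      exact hg (by rw [Matrix.det_fin_two, hcon.1, hcon.2]; ring)
  · rw [h.turn_of_pos hp, h'.turn_of_pos (by positivity), mul_zero]

theorem turn_of_isReparam {g : GL (Fin 2) ℝ} {p q : KnotParam 2} (h : IsReparam g p q) :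
    turn q.1.1 = SignType.sign g.1.det * turn p.1.1 := by
  obtain ⟨c, hc, h⟩ := isReparam_iff.mp h
  obtain ⟨β, hβ, hp⟩ := (isRationalCurve_iff p.1.1).mp p.1.2
  rw [h, hp.turn_smul_subst hβ hc (Matrix.isUnits_det_units g).ne_zero]

theorem turn_smul {c : ℝ} (hc : c ≠ 0) (p : Param 2) : turn (c • p.1) = turn p.1 := by
  obtain ⟨β, hβ, hp⟩ := (isRationalCurve_iff p.1).mp p.2
  have h1 : subst 1 p.1 = p.1 := evalAt_injective fun x => by rw [evalAt_subst, Matrix.one_mulVec]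
  have := hp.turn_smul_subst hβ hc (g := 1) (by simp)
  rwa [h1, Matrix.det_one, sign_one, one_mul] at this

/-- Reparametrisation by any projective transformation is possible, in particular every knot has a
reverse. -/
theorem exists_isReparam (p : KnotParam 2) (g : GL (Fin 2) ℝ) : ∃ q, IsReparam g p q := by
  obtain ⟨β, hβ, hp⟩ := (isRationalCurve_iff p.1.1).mp p.1.2
  have hg : g.1.det ≠ 0 := (Matrix.isUnits_det_units g).ne_zero
  have hq := (hp.subst g.1).isRationalCurve (by positivity)
  exact ⟨⟨⟨_, hq⟩, isNonsingular_of_degree_two _⟩,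
    isReparam_iff.mpr ⟨1, one_ne_zero, (one_smul ℝ _).symm⟩⟩

/-! ### Orthogonal frames and their normal forms -/

/-- The orthogonal frames whose vectors have squares `β, β, -β`. They correspond to the conics
`A s² + B s t + C t²` through `(B, A - C, A + C)`. -/
def frames (β : ℝ) : Set (Fin 5 → Fin 3 → ℝ) :=
  {F | ∀ k l, form (F · k) (F · l) = β * Matrix.diagonal ![1, 1, -1] k l}

theorem mem_frames_iff {β : ℝ} {F : Fin 5 → Fin 3 → ℝ} : F ∈ frames β ↔ ∀ k l,
    -(F 0 k * F 0 l) + F 1 k * F 1 l + F 2 k * F 2 l + F 3 k * F 3 l - F 4 k * F 4 l =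
      β * Matrix.diagonal ![1, 1, -1] k l :=
  forall₂_congr fun _ _ => by rw [form_apply]

/-- The linear transformation of the plane of the coordinates `i, j` with the given matrix,
applied to the vectors of a frame. -/
def planar (i j : Fin 5) (a b c d : ℝ) (F : Fin 5 → Fin 3 → ℝ) : Fin 5 → Fin 3 → ℝ := fun l k =>
  if l = i then a * F i k + b * F j k else if l = j then c * F i k + d * F j k else F l k

theorem planar_mem_frames {i j : Fin 5} (hij : i ≠ j) {a b c d : ℝ}
    (haa : eta i * a ^ 2 + eta j * c ^ 2 = eta i) (hab : eta i * (a * b) + eta j * (c * d) = 0)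
    (hbb : eta i * b ^ 2 + eta j * d ^ 2 = eta j) {β : ℝ} {F : Fin 5 → Fin 3 → ℝ}
    (hF : F ∈ frames β) : planar i j a b c d F ∈ frames β := by
  intro k l
  rw [← hF k l, ← sub_eq_zero, form, form, ← Finset.sum_sub_distrib,
    ← Finset.sum_subset (Finset.subset_univ {i, j}), Finset.sum_pair hij]
  · simp only [planar, if_true, if_neg hij.symm]
    linear_combination F i k * F i l * haa + (F i k * F j l + F j k * F i l) * hab +
      F j k * F j l * hbb
  · intro m _ hm
    simp only [Finset.mem_insert, Finset.mem_singleton, not_or] at hm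
    simp [planar, hm.1, hm.2]

/-- The outcome of moving a frame by a transformation of the coordinates `i, j` so that
the `k`-th vector has `j`-th coordinate zero. -/
structure Eliminated (β : ℝ) (i j : Fin 5) (k : Fin 3) (F G : Fin 5 → Fin 3 → ℝ) : Prop where
  joined : JoinedIn (frames β) F G
  eq_zero : G j k = 0
  other : ∀ l, l ≠ i → l ≠ j → G l = F l
  left : ∀ m, F i m = 0 → F j m = 0 → G i m = 0
  right : ∀ m, F i m = 0 → F j m = 0 → G j m = 0

/-- A one-parameter family of isometries of a coordinate plane that starts at the identity carries a
frame along a path of frames. -/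
theorem planar_eliminated {i j : Fin 5} (hij : i ≠ j) {a b c d : ℝ → ℝ} (ha : Continuous a)
    (hb : Continuous b) (hc : Continuous c) (hd : Continuous d)
    (haa : ∀ t, eta i * a t ^ 2 + eta j * c t ^ 2 = eta i)
    (hab : ∀ t, eta i * (a t * b t) + eta j * (c t * d t) = 0)
    (hbb : ∀ t, eta i * b t ^ 2 + eta j * d t ^ 2 = eta j)
    (ha0 : a 0 = 1) (hb0 : b 0 = 0) (hc0 : c 0 = 0) (hd0 : d 0 = 1)
    {β : ℝ} {F : Fin 5 → Fin 3 → ℝ} (hF : F ∈ frames β) {k : Fin 3} {t : ℝ}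
    (ht : c t * F i k + d t * F j k = 0) :
    Eliminated β i j k F (planar i j (a t) (b t) (c t) (d t) F) where
  joined := by
    refine JoinedIn.ofLine (f := fun u => planar i j (a (u * t)) (b (u * t)) (c (u * t))
      (d (u * t)) F) (Continuous.continuousOn ?_) ?_ (by simp only [one_mul]) ?_
    · refine continuous_pi fun l => continuous_pi fun m => ?_
      unfold planar
      split_ifs <;> fun_prop
    · ext l m
      simp only [zero_mul, ha0, hb0, hc0, hd0, planar]
      split_ifs with h1 h2
      · simp [h1]
      · simp [h2]
      · rfl
    · rintro _ ⟨u, -, rfl⟩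
      exact planar_mem_frames hij (haa _) (hab _) (hbb _) hF
  eq_zero := by simp [planar, hij.symm, ht]
  other l hi hj := by ext m; simp [planar, hi, hj]
  left m hi hj := by simp [planar, hi, hj]
  right m hi hj := by simp [planar, hij.symm, hi, hj]

/-- In a definite coordinate plane, a rotation takes any vector to the nonnegative half of the first
axis. -/
theorem exists_rotate {i j : Fin 5} (hij : i ≠ j) (he : eta i = eta j) (k : Fin 3) {β : ℝ}
    {F : Fin 5 → Fin 3 → ℝ} (hF : F ∈ frames β) :
    ∃ G, Eliminated β i j k F G ∧ 0 ≤ G i k := by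
  let z : ℂ := ⟨F i k, F j k⟩
  have h1 : ‖z‖ * Real.cos z.arg = F i k := Complex.norm_mul_cos_arg z
  have h2 : ‖z‖ * Real.sin z.arg = F j k := Complex.norm_mul_sin_arg z
  refine ⟨_, planar_eliminated hij (a := Real.cos) (b := Real.sin) (c := fun t => -Real.sin t)
    (d := Real.cos) (by fun_prop) (by fun_prop) (by fun_prop) (by fun_prop) (fun t => ?_)
    (fun t => ?_) (fun t => ?_) (by simp) (by simp) (by simp) (by simp) hF (t := z.arg) ?_, ?_⟩
  · rw [he]; linear_combination eta j * Real.sin_sq_add_cos_sq t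
  · rw [he]; ring
  · rw [he]; linear_combination eta j * Real.sin_sq_add_cos_sq t
  · rw [← h1, ← h2]; ring
  · simp only [planar, if_true]
    have : Real.cos z.arg * F i k + Real.sin z.arg * F j k = ‖z‖ := by
      rw [← h1, ← h2]
      linear_combination ‖z‖ * Real.sin_sq_add_cos_sq z.arg
    rw [this]
    exact norm_nonneg z

/-- In an indefinite coordinate plane, a hyperbolic rotation takes a vector to the first axis if its
square has the sign of that axis; the half of the axis cannot be chosen. -/
theorem exists_boost {i j : Fin 5} (hij : i ≠ j) (he : eta i = -eta j) (k : Fin 3) {β : ℝ}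
    {F : Fin 5 → Fin 3 → ℝ} (hF : F ∈ frames β) (hlt : F j k ^ 2 < F i k ^ 2) :
    ∃ G, Eliminated β i j k F G ∧ (0 ≤ F i k → 0 ≤ G i k) := by
  have hx : F i k ≠ 0 := by
    intro h
    rw [h] at hlt
    nlinarith [sq_nonneg (F j k)]
  have hr : -(F j k / F i k) ∈ Set.Ioo (-1 : ℝ) 1 := by
    have h1 : |F j k / F i k| < 1 := by
      rw [abs_div, div_lt_one (abs_pos.mpr hx)]
      exact sq_lt_sq.mp hlt
    obtain ⟨h2, h3⟩ := abs_lt.mp h1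
    constructor <;> linarith
  -- the rapidity at which the second coordinate vanishes
  set t := Real.artanh (-(F j k / F i k)) with ht
  have htanh : Real.sinh t = -(F j k / F i k) * Real.cosh t := by
    rw [← Real.tanh_artanh hr, ← ht, Real.tanh_eq_sinh_div_cosh]
    field_simp [(Real.cosh_pos t).ne']
  refine ⟨_, planar_eliminated hij (a := Real.cosh) (b := Real.sinh) (c := Real.sinh)
    (d := Real.cosh) (by fun_prop) (by fun_prop) (by fun_prop) (by fun_prop) (fun t => ?_)
    (fun t => ?_) (fun t => ?_) (by simp) (by simp) (by simp) (by simp) hF (t := t) ?_, ?_⟩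
  · rw [he]; linear_combination -eta j * Real.cosh_sq t
  · rw [he]; ring
  · rw [he]; linear_combination eta j * Real.cosh_sq t
  · rw [htanh]; field_simp; ring
  · intro h0
    simp only [planar, if_true]
    have h3 : Real.cosh t * F i k + Real.sinh t * F j k =
        Real.cosh t * (F i k ^ 2 - F j k ^ 2) / F i k := by
      rw [htanh]
      field_simp
      ring
    rw [h3]
    have := sub_pos.mpr hlt
    have := Real.cosh_pos t
    positivity

theorem exists_rotate_space (k : Fin 3) {β : ℝ} {F : Fin 5 → Fin 3 → ℝ} (hF : F ∈ frames β) :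
    ∃ G, JoinedIn (frames β) F G ∧ G 0 = F 0 ∧ G 4 = F 4 ∧ 0 ≤ G 1 k ∧ G 2 k = 0 ∧ G 3 k = 0 ∧
      ∀ m, F 1 m = 0 → F 2 m = 0 → F 3 m = 0 → G 1 m = 0 ∧ G 2 m = 0 ∧ G 3 m = 0 := by
  obtain ⟨G, E, -⟩ := exists_rotate (i := 1) (j := 2) (by decide) rfl k hF
  obtain ⟨H, E', p⟩ := exists_rotate (i := 1) (j := 3) (by decide) rfl k E.joined.target_mem
  have o2 := E'.other 2 (by decide) (by decide)
  have o3 := E.other 3 (by decide) (by decide)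
  refine ⟨H, E.joined.trans E'.joined, ?_, ?_, p, ?_, E'.eq_zero, fun m h1 h2 h3 => ?_⟩
  · rw [E'.other 0 (by decide) (by decide), E.other 0 (by decide) (by decide)]
  · rw [E'.other 4 (by decide) (by decide), E.other 4 (by decide) (by decide)]
  · rw [o2, E.eq_zero]
  · have h1' := E.left m h1 h2
    have h3' : G 3 m = 0 := by rw [o3, h3]
    exact ⟨E'.left m h1' h3', by rw [o2, E.right m h1 h2], E'.right m h1' h3'⟩

theorem eq_one_of_nonneg {x : ℝ} (h : x * x = 1) (h0 : 0 ≤ x) : x = 1 := by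
  nlinarith

/-- A frame of type `(-,-,+)` is moved to one of two normal forms: rotations and boosts turn
the first vector into the first basis vector, then the second into plus or minus the last one. The sign
remains because a boost cannot reverse a negative vector. -/
theorem exists_joinedIn_frames_neg {F : Fin 5 → Fin 3 → ℝ} (hF : F ∈ frames (-1)) :
    ∃ e : ℝ, (e = 1 ∨ e = -1) ∧ JoinedIn (frames (-1)) F
      ![![1, 0, 0], ![0, 0, 1], ![0, 0, 0], ![0, 0, 0], ![0, e, 0]] := by
  obtain ⟨F1, E1, p1⟩ := exists_rotate (i := 0) (j := 4) (by decide) rfl 0 hF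
  obtain ⟨F2, J2, r20, r24, -, z22, z23, -⟩ := exists_rotate_space 0 E1.joined.target_mem
  have z24 : F2 4 0 = 0 := by rw [r24, E1.eq_zero]
  have g2 := mem_frames_iff.mp J2.target_mem 0 0
  simp [z22, z23, z24] at g2
  obtain ⟨F3, E3, p3⟩ := exists_boost (i := 0) (j := 1) (by decide) (by simp [eta]) 0
    J2.target_mem (by nlinarith)
  replace p3 := p3 (by rw [r20]; exact p1)
  have z31 := E3.eq_zero
  have z32 : F3 2 0 = 0 := by rw [E3.other 2 (by decide) (by decide), z22]
  have z33 : F3 3 0 = 0 := by rw [E3.other 3 (by decide) (by decide), z23]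
  have z34 : F3 4 0 = 0 := by rw [E3.other 4 (by decide) (by decide), z24]
  have g3 := fun l => mem_frames_iff.mp E3.joined.target_mem 0 l
  have c0 := g3 0
  have c1 := g3 1
  have c2 := g3 2
  simp [z31, z32, z33, z34] at c0 c1 c2
  replace c0 := eq_one_of_nonneg c0 p3
  simp [c0] at c1 c2
  obtain ⟨F4, J4, r40, r44, -, z42, z43, k4⟩ := exists_rotate_space 1 E3.joined.target_mem
  obtain ⟨y41, y42, y43⟩ := k4 0 z31 z32 z33
  have g4 := mem_frames_iff.mp J4.target_mem 1 1
  simp [z42, z43, r40, c1] at g4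
  obtain ⟨F5, E5, -⟩ := exists_boost (i := 4) (j := 1) (by decide) (by simp [eta]) 1
    J4.target_mem (by nlinarith)
  have y54 := E5.left 0 (by rw [r44, z34]) y41
  have y51 := E5.right 0 (by rw [r44, z34]) y41
  have o50 := (E5.other 0 (by decide) (by decide)).trans r40
  have o52 := E5.other 2 (by decide) (by decide)
  have o53 := E5.other 3 (by decide) (by decide)
  have z51 := E5.eq_zero
  have d1 := mem_frames_iff.mp E5.joined.target_mem 1 1
  have d2 := mem_frames_iff.mp E5.joined.target_mem 1 2
  simp [z51, o50, o52, o53, z42, z43, c1] at d1 d2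
  have he : F5 4 1 = 1 ∨ F5 4 1 = -1 := mul_self_eq_one_iff.mp d1
  replace d2 : F5 4 2 = 0 := d2.resolve_left (by rcases he with h | h <;> rw [h] <;> norm_num)
  obtain ⟨F6, J6, r60, r64, p6, z62, z63, k6⟩ := exists_rotate_space 2 E5.joined.target_mem
  obtain ⟨y61, y62, y63⟩ := k6 0 y51 (by rw [o52, y42]) (by rw [o53, y43])
  obtain ⟨x61, x62, x63⟩ := k6 1 z51 (by rw [o52, z42]) (by rw [o53, z43])
  have g6 := mem_frames_iff.mp J6.target_mem 2 2
  simp [z62, z63, r60, r64, o50, c2, d2] at g6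
  replace g6 := eq_one_of_nonneg g6 p6
  refine ⟨F5 4 1, he, ?_⟩
  convert ((((E1.joined.trans J2).trans E3.joined).trans J4).trans E5.joined).trans J6 using 1
  ext i k
  fin_cases i <;> fin_cases k <;> simp [*]

/-- All frames of type `(+,+,-)` are moved to one normal form by rotations and boosts, the
three vectors in turn. -/
theorem joinedIn_frames_pos {F : Fin 5 → Fin 3 → ℝ} (hF : F ∈ frames 1) :
    JoinedIn (frames 1) F
      ![![0, 0, 1], ![1, 0, 0], ![0, 1, 0], ![0, 0, 0], ![0, 0, 0]] := by
  obtain ⟨F1, E1, -⟩ := exists_rotate (i := 0) (j := 4) (by decide) rfl 0 hF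
  obtain ⟨F2, J2, r20, r24, p2, z22, z23, -⟩ := exists_rotate_space 0 E1.joined.target_mem
  have z24 : F2 4 0 = 0 := by rw [r24, E1.eq_zero]
  have g2 := mem_frames_iff.mp J2.target_mem 0 0
  simp [z22, z23, z24] at g2
  obtain ⟨F3, E3, p3⟩ := exists_boost (i := 1) (j := 0) (by decide) (by simp [eta]) 0
    J2.target_mem (by nlinarith)
  replace p3 := p3 p2
  have z30 := E3.eq_zero
  have z32 : F3 2 0 = 0 := by rw [E3.other 2 (by decide) (by decide), z22]
  have z33 : F3 3 0 = 0 := by rw [E3.other 3 (by decide) (by decide), z23]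
  have z34 : F3 4 0 = 0 := by rw [E3.other 4 (by decide) (by decide), z24]
  have g3 := fun l => mem_frames_iff.mp E3.joined.target_mem 0 l
  have c0 := g3 0
  have c1 := g3 1
  have c2 := g3 2
  simp [z30, z32, z33, z34] at c0 c1 c2
  replace c0 := eq_one_of_nonneg c0 p3
  simp [c0] at c1 c2
  obtain ⟨F4, E4, -⟩ := exists_rotate (i := 0) (j := 4) (by decide) rfl 1 E3.joined.target_mem
  have y40 := E4.left 0 z30 z34
  have y44 := E4.right 0 z30 z34
  have o41 := E4.other 1 (by decide) (by decide)
  obtain ⟨F5, E5, p5⟩ := exists_rotate (i := 2) (j := 3) (by decide) rfl 1 E4.joined.target_mem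
  have y52 := E5.left 0 (by rw [E4.other 2 (by decide) (by decide), z32])
    (by rw [E4.other 3 (by decide) (by decide), z33])
  have y53 := E5.right 0 (by rw [E4.other 2 (by decide) (by decide), z32])
    (by rw [E4.other 3 (by decide) (by decide), z33])
  have o50 := E5.other 0 (by decide) (by decide)
  have o51 := (E5.other 1 (by decide) (by decide)).trans o41
  have z54 : F5 4 1 = 0 := by rw [E5.other 4 (by decide) (by decide), E4.eq_zero]
  have y54 : F5 4 0 = 0 := by rw [E5.other 4 (by decide) (by decide), y44]
  have z53 := E5.eq_zero
  have g5 := mem_frames_iff.mp E5.joined.target_mem 1 1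
  simp [z53, z54, o51, c1] at g5
  obtain ⟨F6, E6, p6⟩ := exists_boost (i := 2) (j := 0) (by decide) (by simp [eta]) 1
    E5.joined.target_mem (by nlinarith)
  replace p6 := p6 p5
  have y62 := E6.left 0 y52 (by rw [o50, y40])
  have y60 := E6.right 0 y52 (by rw [o50, y40])
  have z60 := E6.eq_zero
  have o61 := (E6.other 1 (by decide) (by decide)).trans o51
  have o63 := E6.other 3 (by decide) (by decide)
  have o64 := E6.other 4 (by decide) (by decide)
  have d1 := mem_frames_iff.mp E6.joined.target_mem 1 1
  have d2 := mem_frames_iff.mp E6.joined.target_mem 1 2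
  simp [z60, o61, o63, o64, z53, z54, c1] at d1 d2
  replace d1 := eq_one_of_nonneg d1 p6
  simp [d1] at d2
  obtain ⟨F7, E7, p7⟩ := exists_rotate (i := 0) (j := 4) (by decide) rfl 2 E6.joined.target_mem
  have y70 := E7.left 0 y60 (by rw [o64, y54])
  have y74 := E7.right 0 y60 (by rw [o64, y54])
  have x70 := E7.left 1 z60 (by rw [o64, z54])
  have x74 := E7.right 1 z60 (by rw [o64, z54])
  have z74 := E7.eq_zero
  have o71 := (E7.other 1 (by decide) (by decide)).trans o61
  have o72 := E7.other 2 (by decide) (by decide)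
  have o73 := (E7.other 3 (by decide) (by decide)).trans o63
  have g7 := mem_frames_iff.mp E7.joined.target_mem 2 2
  simp [z74, o71, o72, c2, d2] at g7
  obtain ⟨F8, E8, p8⟩ := exists_boost (i := 0) (j := 3) (by decide) (by simp [eta]) 2
    E7.joined.target_mem (by nlinarith)
  replace p8 := p8 p7
  have y80 := E8.left 0 y70 (by rw [o73, y53])
  have y83 := E8.right 0 y70 (by rw [o73, y53])
  have x80 := E8.left 1 x70 (by rw [o73, z53])
  have x83 := E8.right 1 x70 (by rw [o73, z53])
  have z83 := E8.eq_zero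
  have o81 := (E8.other 1 (by decide) (by decide)).trans o71
  have o82 := (E8.other 2 (by decide) (by decide)).trans o72
  have o84 := E8.other 4 (by decide) (by decide)
  have g8 := mem_frames_iff.mp E8.joined.target_mem 2 2
  simp [z83, o81, o82, o84, c2, d2, z74] at g8
  replace g8 := eq_one_of_nonneg g8 p8
  convert ((((((E1.joined.trans J2).trans E3.joined).trans E4.joined).trans E5.joined).trans
    E6.joined).trans E7.joined).trans E8.joined using 1
  ext i k
  fin_cases i <;> fin_cases k <;> simp [*]

/-! ### Path components of the space of conics -/

/-- The conic with `B, A - C, A + C` the vectors of a given frame. -/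
noncomputable def ofFrame (F : Fin 5 → Fin 3 → ℝ) : FormTuple 2 := fun i =>
  ![(F i 1 + F i 2) / 2, F i 0, (F i 2 - F i 1) / 2]

theorem continuous_ofFrame : Continuous ofFrame := by
  refine continuous_pi fun i => continuous_pi fun k => ?_
  unfold ofFrame
  fin_cases k <;> simp <;> fun_prop

theorem isConic_ofFrame {β : ℝ} {F : Fin 5 → Fin 3 → ℝ} (hF : F ∈ frames β) :
    IsConic (ofFrame F) β := by
  have h := mem_frames_iff.mp hF
  have h00 := h 0 0
  have h01 := h 0 1
  have h02 := h 0 2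
  have h11 := h 1 1
  have h12 := h 1 2
  have h22 := h 2 2
  simp only [Matrix.diagonal_apply, Matrix.cons_val, if_true, Fin.reduceEq, if_false]
    at h00 h01 h02 h11 h12 h22
  constructor <;> simp only [form_apply, ofFrame, Matrix.cons_val]
  · linear_combination (h11 + 2 * h12 + h22) / 4
  · linear_combination (h01 + h02) / 2
  · linear_combination (h22 - h11) / 4
  · linear_combination h00
  · linear_combination (h02 - h01) / 2
  · linear_combination (h11 - 2 * h12 + h22) / 4

theorem IsConic.exists_frame {p : FormTuple 2} {β : ℝ} (h : IsConic p β) :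
    ∃ F ∈ frames β, ofFrame F = p := by
  refine ⟨fun i => ![p i 1, p i 0 - p i 2, p i 0 + p i 2], mem_frames_iff.mpr ?_, ?_⟩
  · obtain ⟨e00, e01, e02, e11, e12, e22⟩ := h
    rw [form_apply] at e00 e01 e02 e11 e12 e22
    intro k l
    fin_cases k <;> fin_cases l <;> simp
    · linear_combination e11
    · linear_combination e01 - e12
    · linear_combination e01 + e12
    · linear_combination e01 - e12
    · linear_combination e00 + e22 - 2 * e02
    · linear_combination e00 - e22
    · linear_combination e01 + e12
    · linear_combination e00 - e22
    · linear_combination e00 + e22 + 2 * e02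
  · ext i k
    fin_cases k <;> simp [ofFrame]

theorem joinedIn_ofFrame {β : ℝ} (hβ : β ≠ 0) {F G : Fin 5 → Fin 3 → ℝ}
    (h : JoinedIn (frames β) F G) :
    JoinedIn {p | IsRationalCurve p} (ofFrame F) (ofFrame G) := by
  obtain ⟨γ, hγ⟩ := h
  exact ⟨γ.map continuous_ofFrame, fun t => (isConic_ofFrame (hγ t)).isRationalCurve hβ⟩

/-- Scaling by a positive factor normalises `β` to `1` or `-1`. -/
theorem IsConic.joinedIn_smul {p : FormTuple 2} {β : ℝ} (h : IsConic p β) (hβ : β ≠ 0) :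
    ∃ c : ℝ, c ^ 2 * |β| = 1 ∧ JoinedIn {p | IsRationalCurve p} p (c • p) := by
  have hb : 0 < √|β| := Real.sqrt_pos.mpr (abs_pos.mpr hβ)
  have hc : 0 < (√|β|)⁻¹ := inv_pos.mpr hb
  refine ⟨(√|β|)⁻¹, ?_, ?_⟩
  · rw [inv_pow, Real.sq_sqrt (abs_nonneg β), inv_mul_cancel₀ (abs_ne_zero.mpr hβ)]
  · refine JoinedIn.ofLine (f := fun t : ℝ => ((1 - t) + t * (√|β|)⁻¹) • p)
      (Continuous.continuousOn (by fun_prop)) (by simp) (by simp) ?_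
    rintro _ ⟨t, ⟨ht0, ht1⟩, rfl⟩
    refine (h.smul _).isRationalCurve (mul_ne_zero (pow_ne_zero 2 (ne_of_gt ?_)) hβ)
    rcases ht0.eq_or_lt with rfl | ht0
    · simp
    · have : 0 < t * (√|β|)⁻¹ := mul_pos ht0 hc
      linarith

/-- One conic for each sense of rotation. -/
noncomputable def model (s : SignType) : FormTuple 2 :=
  if s = 0 then ofFrame ![![0, 0, 1], ![1, 0, 0], ![0, 1, 0], ![0, 0, 0], ![0, 0, 0]]
  else ofFrame ![![1, 0, 0], ![0, 0, 1], ![0, 0, 0], ![0, 0, 0], ![0, -(s : ℝ), 0]]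

theorem isConic_model_zero : IsConic (model 0) 1 := by
  rw [model, if_pos rfl]
  refine isConic_ofFrame (mem_frames_iff.mpr fun k l => ?_)
  fin_cases k <;> fin_cases l <;> simp

theorem isConic_model {s : SignType} (hs : s ≠ 0) : IsConic (model s) (-1) := by
  rw [model, if_neg hs]
  refine isConic_ofFrame (mem_frames_iff.mpr fun k l => ?_)
  cases s <;> simp at hs <;> fin_cases k <;> fin_cases l <;> simp

theorem isRationalCurve_model (s : SignType) : IsRationalCurve (model s) := by
  by_cases hs : s = 0
  · subst hs
    exact isConic_model_zero.isRationalCurve one_ne_zero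
  · exact (isConic_model hs).isRationalCurve (by norm_num)

theorem turn_model (s : SignType) : turn (model s) = s := by
  by_cases hs : s = 0
  · subst hs
    exact isConic_model_zero.turn_of_pos one_pos
  · rw [(isConic_model hs).turn_of_neg (by norm_num), model, if_neg hs]
    have hD : negDet (ofFrame ![![1, 0, 0], ![0, 0, 1], ![0, 0, 0], ![0, 0, 0],
        ![0, -(s : ℝ), 0]]) = (s : ℝ) / 2 := by
      simp only [negDet, ofFrame, Matrix.cons_val]
      ring
    rw [hD]
    cases s
    · simp at hs
    · simpa using sign_neg (a := (-1 / 2 : ℝ)) (by norm_num)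
    · simp

theorem eq_of_joined {Y T : Type*} [TopologicalSpace Y] [TopologicalSpace T] [DiscreteTopology T]
    {f : Y → T} (hf : Continuous f) {x y : Y} (h : Joined x y) : f x = f y := by
  obtain ⟨γ⟩ := h
  have := PreconnectedSpace.constant (inferInstanceAs (PreconnectedSpace unitInterval))
    (hf.comp γ.continuous) (x := 0) (y := 1)
  simpa using this

theorem exists_joined_model (p : Param 2) :
    ∃ s, Joined p ⟨model s, isRationalCurve_model s⟩ := by
  obtain ⟨β, hβ, h⟩ := (isRationalCurve_iff p.1).mp p.2
  obtain ⟨c, hc, hj⟩ := h.joinedIn_smul hβ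
  suffices ∃ s, JoinedIn {p | IsRationalCurve p} (c • p.1) (model s) by
    obtain ⟨s, hs⟩ := this
    exact ⟨s, (joinedIn_iff_joined p.2 (isRationalCurve_model s)).mp (hj.trans hs)⟩
  obtain ⟨F, hF, hFp⟩ := (h.smul c).exists_frame
  rw [← hFp]
  rcases lt_or_gt_of_ne hβ with hn | hp
  · rw [abs_of_neg hn] at hc
    rw [show c ^ 2 * β = -1 by linarith] at hF
    obtain ⟨e, he, hj⟩ := exists_joinedIn_frames_neg hF
    replace hj := joinedIn_ofFrame (by norm_num) hj
    rcases he with rfl | rfl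
    · exact ⟨-1, by simpa [model] using hj⟩
    · exact ⟨1, by simpa [model] using hj⟩
  · rw [abs_of_pos hp] at hc
    rw [hc] at hF
    exact ⟨0, by simpa [model] using joinedIn_ofFrame one_ne_zero (joinedIn_frames_pos hF)⟩

theorem joined_iff_turn_eq {p q : Param 2} : Joined p q ↔ turn p.1 = turn q.1 := by
  refine ⟨eq_of_joined continuous_turn, fun h => ?_⟩
  obtain ⟨s, hs⟩ := exists_joined_model p
  obtain ⟨r, hr⟩ := exists_joined_model q
  have h1 := eq_of_joined continuous_turn hs
  have h2 := eq_of_joined continuous_turn hr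
  rw [turn_model] at h1 h2
  have : s = r := by rw [← h1, ← h2, h]
  subst this
  exact hs.trans hr.symm

/-! ### Counting components by a discrete invariant -/

section Counting

variable {Y T : Type*} [TopologicalSpace Y] [TopologicalSpace T] [DiscreteTopology T] {f : Y → T}

/-- A complete continuous invariant with discrete values identifies the path components with its
values. -/
noncomputable def zerothHomotopyEquiv (hf : Continuous f) (hs : Function.Surjective f)
    (hj : ∀ x y, f x = f y → Joined x y) : ZerothHomotopy Y ≃ T :=
  Equiv.ofBijective
    (Quotient.lift (s := pathSetoid Y) f fun _ _ h => eq_of_joined hf h) (by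
      constructor
      · rintro ⟨x⟩ ⟨y⟩ h
        exact Quotient.sound (s := pathSetoid Y) (hj x y h)
      · intro t
        obtain ⟨y, rfl⟩ := hs t
        exact ⟨Quotient.mk (pathSetoid Y) y, rfl⟩)

theorem card_connectedComponents (hf : Continuous f) (hs : Function.Surjective f)
    (hj : ∀ x y, f x = f y → Joined x y) : Nat.card (ConnectedComponents Y) = Nat.card T := by
  refine Nat.card_congr (Equiv.ofBijective hf.connectedComponentsLift ⟨?_, ?_⟩)
  · intro x y h
    obtain ⟨x, rfl⟩ := ConnectedComponents.surjective_coe x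
    obtain ⟨y, rfl⟩ := ConnectedComponents.surjective_coe y
    simp only [Continuous.connectedComponentsLift_apply_coe] at h
    rw [ConnectedComponents.coe_eq_coe']
    exact pathComponent_subset_component y (hj y x h.symm)
  · intro t
    obtain ⟨y, rfl⟩ := hs t
    exact ⟨y, hf.connectedComponentsLift_apply_coe y⟩

end Counting

theorem ncard_setOf_equiv {α β : Type*} (e : α ≃ β) (P : β → Prop) :
    {a | P (e a)}.ncard = {b | P b}.ncard := by
  rw [← Set.ncard_image_of_injective _ e.injective]
  congr 1
  ext b
  constructor
  · rintro ⟨a, ha, rfl⟩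
    exact ha
  · intro hb
    exact ⟨e.symm b, by simpa using hb, by simp⟩

/-! ### The three spaces -/

/-- Every conic parametrises a knot. -/
def toKnot (p : Param 2) : KnotParam 2 := ⟨p, isNonsingular_of_degree_two p⟩

theorem continuous_toKnot : Continuous toKnot := continuous_id.subtype_mk _

theorem joined_knotParam {p q : KnotParam 2} (h : turn p.1.1 = turn q.1.1) : Joined p q :=
  (joined_iff_turn_eq.mpr h : Joined p.1 q.1).map continuous_toKnot

theorem continuous_turn_knotParam : Continuous fun p : KnotParam 2 => turn p.1.1 :=
  continuous_turn.comp continuous_subtype_val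

/-- The sense of rotation on the space of parametrisations. -/
noncomputable def paramTurn : ParamSpace 2 → SignType :=
  Quotient.lift (fun p => turn p.1) (by
    rintro p q ⟨c, hc, h⟩
    simp only [h, turn_smul hc])

/-- The sense of rotation of an oriented knot. -/
noncomputable def orientedTurn : OrientedKnot 2 → SignType :=
  Quotient.lift (fun p => turn p.1.1) (by
    rintro p q ⟨g, hg, h⟩
    have hdet : 0 < g.1.det := hg
    simp only [turn_of_isReparam h, sign_pos hdet, one_mul])

/-- Whether a knot without orientation has no sense of rotation, that is, lies in a plane of
signature `(2,1)`. -/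
noncomputable def unorientedTurn : UnorientedKnot 2 → Bool :=
  Quotient.lift (fun p => decide (turn p.1.1 = 0)) (by
    rintro p q ⟨g, hg, h⟩
    have hdet : g.1.det ≠ 0 := (Matrix.isUnits_det_units g).ne_zero
    have hs : SignType.sign g.1.det ≠ 0 := by simpa using hdet
    simp only [turn_of_isReparam h, mul_eq_zero, hs, false_or])

theorem exists_turn_eq (s : SignType) : ∃ p : Param 2, turn p.1 = s :=
  ⟨⟨model s, isRationalCurve_model s⟩, turn_model s⟩

theorem card_connectedComponents_paramSpace :
    Nat.card (ConnectedComponents (ParamSpace 2)) = 3 := by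
  rw [card_connectedComponents (f := paramTurn) (continuous_turn.quotient_lift _),
    Nat.card_eq_fintype_card]
  · rfl
  · intro s
    obtain ⟨p, hp⟩ := exists_turn_eq s
    exact ⟨Quotient.mk _ p, hp⟩
  · rintro ⟨p⟩ ⟨q⟩ h
    exact (joined_iff_turn_eq.mpr h).map continuous_quotient_mk'

/-- The oriented classes are determined by the sense of rotation. -/
noncomputable def orientedEquiv : ZerothHomotopy (OrientedKnot 2) ≃ SignType :=
  zerothHomotopyEquiv (f := orientedTurn) (continuous_turn_knotParam.quotient_lift _)
    (fun s => by
      obtain ⟨p, hp⟩ := exists_turn_eq s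
      exact ⟨(toKnot p).oriented, hp⟩)
    (by
      rintro ⟨p⟩ ⟨q⟩ h
      exact (joined_knotParam h).map continuous_quotient_mk')

theorem joined_oriented_iff {p q : KnotParam 2} :
    Joined p.oriented q.oriented ↔ turn p.1.1 = turn q.1.1 :=
  ⟨eq_of_joined (f := orientedTurn) (continuous_turn_knotParam.quotient_lift _),
    fun h => (joined_knotParam h).map continuous_quotient_mk'⟩

/-- The reversal of the orientation of the projective line. -/
noncomputable def reversal : GL (Fin 2) ℝ :=
  Matrix.GeneralLinearGroup.mkOfDetNeZero !![1, 0; 0, -1] (by simp)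

theorem joined_unoriented {p q : KnotParam 2} (h : turn p.1.1 = 0 ↔ turn q.1.1 = 0) :
    Joined p.unoriented q.unoriented := by
  by_cases hpq : turn p.1.1 = turn q.1.1
  · exact (joined_knotParam hpq).map continuous_quotient_mk'
  · -- opposite senses of rotation: pass to the reverse of the first knot
    obtain ⟨r, hr⟩ := exists_isReparam p reversal
    have hdet : reversal.1.det < 0 := by
      simp [reversal, Matrix.GeneralLinearGroup.mkOfDetNeZero]
    have hturn := turn_of_isReparam hr
    rw [sign_neg hdet] at hturn
    have e : p.unoriented = r.unoriented := Quotient.sound ⟨reversal, Subgroup.mem_top _, hr⟩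
    rw [e]
    refine (joined_knotParam (p := r) (q := q) ?_).map continuous_quotient_mk'
    rw [hturn]
    revert h hpq
    generalize turn p.1.1 = a
    generalize turn q.1.1 = b
    revert a b
    decide

/-- The classes without orientation are determined by the signature of the plane of the conic. -/
noncomputable def unorientedEquiv : ZerothHomotopy (UnorientedKnot 2) ≃ Bool :=
  zerothHomotopyEquiv (f := unorientedTurn)
    (((continuous_of_discreteTopology (f := fun s : SignType => decide (s = 0))).comp
      continuous_turn_knotParam).quotient_lift _)
    (fun b => by
      obtain ⟨p, hp⟩ := exists_turn_eq (if b then 0 else 1)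
      refine ⟨(toKnot p).unoriented, ?_⟩
      change decide (turn p.1 = 0) = b
      rw [hp]
      cases b <;> simp)
    (by
      rintro ⟨p⟩ ⟨q⟩ h
      exact joined_unoriented (decide_eq_decide.mp h))

theorem unorientedEquiv_forgetClass (C : ZerothHomotopy (OrientedKnot 2)) :
    unorientedEquiv (forgetClass C) = decide (orientedEquiv C = 0) := by
  obtain ⟨⟨p⟩⟩ := C
  rfl

theorem unorientedEquiv_rigidClass (p : KnotParam 2) :
    unorientedEquiv (rigidClass p.unoriented) = decide (turn p.1.1 = 0) := rfl

theorem ncard_forgetClass_fiber (b : Bool) :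
    {C | forgetClass C = unorientedEquiv.symm b}.ncard =
      {s : SignType | decide (s = 0) = b}.ncard := by
  rw [← ncard_setOf_equiv orientedEquiv]
  simp only [Equiv.eq_symm_apply, unorientedEquiv_forgetClass]

end RealRationalCurve

theorem mainTheorem4 :
    -- no real rational curve of degree 2 on the quadric is singular
    (∀ p : RealRationalCurve.Param 2, RealRationalCurve.IsNonsingular p) ∧
    -- the space of real rational parametrisations has three connected components
    Nat.card (ConnectedComponents (RealRationalCurve.ParamSpace 2)) = 3 ∧
    -- there are three rigid isotopy classes of oriented knots
    Nat.card (ZerothHomotopy (RealRationalCurve.OrientedKnot 2)) = 3 ∧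
    -- there are two rigid isotopy classes of knots without orientation
    Nat.card (ZerothHomotopy (RealRationalCurve.UnorientedKnot 2)) = 2 ∧
    -- with orientation one class stays and the other one splits into two
    (∃ a b : ZerothHomotopy (RealRationalCurve.UnorientedKnot 2), a ≠ b ∧
      {C | RealRationalCurve.forgetClass C = a}.ncard = 1 ∧
      {C | RealRationalCurve.forgetClass C = b}.ncard = 2 ∧
      -- a knot is rigidly isotopic to its reverse exactly when it lies in the class that stays
      (∀ (p q : RealRationalCurve.KnotParam 2) (g : GL (Fin 2) ℝ), g.1.det < 0 →
        RealRationalCurve.IsReparam g p q →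
        (Joined p.oriented q.oriented ↔ RealRationalCurve.rigidClass p.unoriented = a))) := by
  refine ⟨RealRationalCurve.isNonsingular_of_degree_two,
    RealRationalCurve.card_connectedComponents_paramSpace, ?_, ?_,
    RealRationalCurve.unorientedEquiv.symm true, RealRationalCurve.unorientedEquiv.symm false,
    by simp, ?_, ?_, fun p q g hg h => ?_⟩
  · rw [Nat.card_congr RealRationalCurve.orientedEquiv, Nat.card_eq_fintype_card]
    rfl
  · rw [Nat.card_congr RealRationalCurve.unorientedEquiv, Nat.card_eq_fintype_card]
    rfl
  · rw [RealRationalCurve.ncard_forgetClass_fiber, Set.ncard_eq_toFinset_card']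
    rfl
  · rw [RealRationalCurve.ncard_forgetClass_fiber, Set.ncard_eq_toFinset_card']
    rfl
  · rw [RealRationalCurve.joined_oriented_iff, Equiv.eq_symm_apply,
      RealRationalCurve.unorientedEquiv_rigidClass, decide_eq_true_iff,
      RealRationalCurve.turn_of_isReparam h, sign_neg hg]
    generalize RealRationalCurve.turn p.1.1 = s
    revert s
    decide
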